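/- All Hilbert spaces are complex. A bounded operator $T$ on $\mathcal H$ is a near-isometry if there is $\delta>0$ with $\delta\|x\|\le\|Tx\|\le\|x\|$ for all $x$, and $T^{*p}T^{p+1}\mathcal H\subseteq T\mathcal H$ for all $p\ge 0$. Let $\{U_{ij}\}_{1\le i<j\le n}$ be commuting unitaries on $\mathcal H$. An $n$-tuple $T=(T_1,\dots,T_n)$ of near-isometries on $\mathcal H$ is a doubly twisted near-isometry with respect to $\{U_{ij}\}$ if $T_i^*T_j=U_{ij}^*T_jT_i^*$, $T_kU_{ij}=U_{ij}T_k$ and $T_iT_j=U_{ij}T_jT_i$ for all $i<j$ and all $k$. Put $I_n=\{1,\dots,n\}$; for $B=\{b_1<\dots<b_r\}\subseteq I_n$ and $\boldsymbol k\in\mathbb N_0^{r}$ put $T_B^{\boldsymbol k}=T_{b_1}^{k_1}\cdots T_{b_r}^{k_r}$. For $A\subseteq I_n$ put $$\mathcal W_A=\bigcap_{i\in A}\ker T_i^*,\qquad \mathcal D_A=\bigcap_{\boldsymbol\ell\in\mathbb N_0^{n-|A|}}T_{I_n\setminus A}^{\boldsymbol\ell}\mathcal W_A,\qquad \mathcal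 H_A=\bigoplus_{\boldsymbol k\in\mathbb N_0^{|A|}}T_A^{\boldsymbol k}\mathcal D_A .$$ (In particular $\mathcal W_\emptyset=\mathcal H$.) For a Hilbert space $\mathcal E$, $H^2_{\mathcal E}(\mathbb D^m)$ is the Hilbert space of functions $f(z)=\sum_{\boldsymbol k}z^{\boldsymbol k}x_{\boldsymbol k}$ on the polydisc $\mathbb D^m$ with $x_{\boldsymbol k}\in\mathcal E$ and $\|f\|^2=\sum_{\boldsymbol k}\|x_{\boldsymbol k}\|^2<\infty$, and $z^{\boldsymbol k}\otimes\eta$ is the function $z\mapsto z^{\boldsymbol k}\eta$. **Theorem.** Let $T=(T_1,\dots,T_n)$ be a doubly twisted near-isometry on $\mathcal H$. Then the closed subspaces $\mathcal H_A$, $A\subseteq I_n$, form a Wold-type decomposition of $\mathcal H$ for $T$: they reduce every $T_i$, $\mathcal H=\bigoplus_{A\subseteq I_n}\mathcal H_A$, and $T_i|_{\mathcal H_A}$ is a shift operator (that is, $\mathcal H_A=\bigoplus_{p\ge0}T_i^p\mathcal W$ for some closed subspace $\mathcal W\subseteq\mathcal H_A$ with $T_i^p\mathcal W\perp T_i^q\mathcal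 W$ for all $p\neq q$) if $i\in A$, and is invertible on $\mathcal H_A$ if $i\notin A$. Fix a nonempty $A=\{a_1<\dots<a_m\}\subseteq I_n$. For $\boldsymbol k\in\mathbb N_0^m$ let $\Lambda_{A,\boldsymbol k}:\mathcal D_A\to T_A^{\boldsymbol k}\mathcal D_A$ be the unitary in the polar decomposition $T_A^{\boldsymbol k}|_{\mathcal D_A}=\Lambda_{A,\boldsymbol k}\,\bigl|T_A^{\boldsymbol k}|_{\mathcal D_A}\bigr|$. Then these unitaries exist, and there are bounded operators $M_{A,1},\dots,M_{A,n}$ on $H^2_{\mathcal D_A}(\mathbb D^{m})$ and a unitary $U_A:\mathcal H_A\to H^2_{\mathcal D_A}(\mathbb D^{m})$ such that $$U_A(T_A^{\boldsymbol k}\eta)=z^{\boldsymbol k}\otimes\Lambda_{A,\boldsymbol k}^*T_A^{\boldsymbol k}\eta\qquad(\boldsymbol k\in\mathbb N_0^m,\ \eta\in\mathcal D_A),$$ $$U_A\,T_s|_{\mathcal H_A}\,U_A^*=M_{A,s}\qquad(1\le s\le n),$$ where, for all $\boldsymbol k\in\mathbb N_0^m$ and $\eta\in\mathcal D_A$, $$M_{A,s}(z^{\boldsymbol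 k}\otimes\eta)=\begin{cases} z^{\boldsymbol k+e_i}\otimes\Lambda_{A,\boldsymbol k+e_i}^*T_{a_i}\Lambda_{A,\boldsymbol k}\eta & \text{if } s=a_i,\ 1\le i\le m,\\ z^{\boldsymbol k}\otimes\Lambda_{A,\boldsymbol k}^*T_s\Lambda_{A,\boldsymbol k}\eta & \text{if } s\notin A.\end{cases}$$ Here $T_{a_i}$ maps $T_A^{\boldsymbol k}\mathcal D_A$ into $T_A^{\boldsymbol k+e_i}\mathcal D_A$ and $T_s$ ($s\notin A$) maps $T_A^{\boldsymbol k}\mathcal D_A$ into itself, so the weights are operators on $\mathcal D_A$; they are uniformly bounded. Thus $(M_{A,a_1},\dots,M_{A,a_m})$ is an operator-valued multishift, and $M_{A,s}$ is block-diagonal for $s\notin A$. -/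

import Mathlib

open scoped InnerProductSpace

noncomputable section

namespace NearIsom

/-! ### The vector-valued Hardy space of the polydisc -/

section Hardy

/-- The open unit polydisc `𝔻^m`. -/
def polydisc (m : ℕ) : Set (Fin m → ℂ) := {z | ∀ i, ‖z i‖ < 1}

/-- The monomial `z^k = z_1^{k_1} ⋯ z_m^{k_m}`. -/
def mpow {m : ℕ} (z : Fin m → ℂ) (k : Fin m → ℕ) : ℂ := ∏ i, z i ^ k i

/-- Square-summable families of vectors of `E`, indexed by `ℕ^m`. -/
abbrev CoeffSpace (m : ℕ) (E : Type*) [NormedAddCommGroup E] : Type _ :=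
  lp (fun _ : Fin m → ℕ => E) 2

lemma one_var_coeff_eq_zero (c : ℕ → ℂ)
    (h : ∀ t : ℂ, ‖t‖ < 1 → HasSum (fun n => t ^ n * c n) 0) : c = 0 := by
  have hp : HasFPowerSeriesAt (fun _ : ℂ => (0 : ℂ)) (FormalMultilinearSeries.ofScalars ℂ c) 0 := by
    rw [hasFPowerSeriesAt_iff]
    filter_upwards [Metric.ball_mem_nhds (0 : ℂ) one_pos] with t ht
    have := h t (by simpa using ht)
    simpa [FormalMultilinearSeries.coeff_ofScalars] using this
  have h0 := hp.eq_zero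
  funext n
  have := congrArg (fun p => FormalMultilinearSeries.coeff p n) h0
  rw [FormalMultilinearSeries.coeff_ofScalars] at this
  rw [this]
  rfl

lemma slice_hasSum {κ : Type*} (e : κ → ℂ) (d : ℕ → κ → ℂ)
    (hz : ∀ t : ℂ, ‖t‖ < 1 → HasSum (fun p : ℕ × κ => t ^ p.1 * (e p.2 * d p.1 p.2)) 0) (n : ℕ) :
    HasSum (fun k => e k * d n k) 0 := by
  have hs : ∀ n, Summable (fun k => e k * d n k) := by
    intro n
    obtain ⟨t, ht, ht0⟩ : ∃ t : ℂ, ‖t‖ < 1 ∧ t ≠ 0 := ⟨1 / 2, by norm_num, by norm_num⟩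
    have h3 : Summable (fun k => t ^ n * (e k * d n k)) := (hz t ht).summable.prod_factor n
    exact (summable_mul_left_iff (pow_ne_zero n ht0)).mp h3
  have hg : (fun n => ∑' k, e k * d n k) = 0 := by
    apply one_var_coeff_eq_zero
    intro t ht
    exact (hz t ht).prod_fiberwise (fun n => (hs n).hasSum.mul_left (t ^ n))
  have h4 := (hs n).hasSum
  have h5 : ∑' k, e k * d n k = 0 := congrFun hg n
  rwa [h5] at h4

lemma scalar_coeff_eq_zero : ∀ (m : ℕ) (c : (Fin m → ℕ) → ℂ),
    (∀ z ∈ polydisc m, HasSum (fun k => mpow z k * c k) 0) → c = 0 := by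
  intro m
  induction m with
  | zero =>
    intro c h
    have h1 := h 0 (fun i => i.elim0)
    funext k
    have h2 := h1.unique (hasSum_unique _)
    rw [Subsingleton.elim k (@default _ Unique.instInhabited)]
    simpa only [mpow, Finset.univ_eq_empty, Finset.prod_empty, one_mul, Pi.zero_apply]
      using h2.symm
  | succ m ih =>
    intro c h
    have hm : ∀ (t : ℂ) (w : Fin m → ℂ) (n : ℕ) (k : Fin m → ℕ),
        mpow (Fin.cons t w : Fin (m + 1) → ℂ) (Fin.cons n k) = t ^ n * mpow w k := by
      intro t w n k
      simp [mpow, Fin.prod_univ_succ]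
    have key : ∀ (n : ℕ) (w : Fin m → ℂ), w ∈ polydisc m →
        HasSum (fun k => mpow w k * c (Fin.cons n k)) 0 := by
      intro n w hw
      have hz : ∀ t : ℂ, ‖t‖ < 1 →
          HasSum (fun p : ℕ × (Fin m → ℕ) =>
            t ^ p.1 * (mpow w p.2 * c (Fin.cons p.1 p.2))) 0 := by
        intro t ht
        have hc : (Fin.cons t w : Fin (m + 1) → ℂ) ∈ polydisc (m + 1) := by
          intro i
          cases i using Fin.cases with
          | zero => exact ht
          | succ j => exact hw j
        have h2 := (Equiv.hasSum_iff (Fin.consEquiv (fun _ : Fin (m + 1) => ℕ))).mpr (h _ hc)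
        have h3 : (fun p : ℕ × (Fin m → ℕ) =>
            t ^ p.1 * (mpow w p.2 * c (Fin.cons p.1 p.2))) =
            (fun k => mpow (Fin.cons t w : Fin (m + 1) → ℂ) k * c k) ∘
              (Fin.consEquiv (fun _ : Fin (m + 1) => ℕ)) := by
          funext p
          rw [← mul_assoc, ← hm]
          rfl
        rw [h3]
        exact h2
      exact slice_hasSum (mpow w) (fun n k => c (Fin.cons n k)) hz n
    funext k
    have h6 := ih (fun j => c (Fin.cons (k 0) j)) (key (k 0))
    have h7 := congrFun h6 (Fin.tail k)
    simpa [Fin.cons_self_tail] using h7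

variable {m : ℕ} {E : Type*} [NormedAddCommGroup E] [InnerProductSpace ℂ E]

/-- `a` is the family of power series coefficients of the function `f` on the polydisc. -/
def IsCoeff (a : CoeffSpace m E) (f : polydisc m → E) : Prop :=
  ∀ z : polydisc m, HasSum (fun k => mpow z.1 k • a k) (f z)

lemma IsCoeff.unique {a b : CoeffSpace m E} {f : polydisc m → E}
    (ha : IsCoeff a f) (hb : IsCoeff b f) : a = b := by
  ext k
  rw [← sub_eq_zero, ← inner_self_eq_zero (𝕜 := ℂ)]
  have := scalar_coeff_eq_zero m (fun j => ⟪a k - b k, a j - b j⟫_ℂ) (fun z hz => by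
    have h1 := ((ha ⟨z, hz⟩).sub (hb ⟨z, hz⟩)).mapL (innerSL ℂ (a k - b k))
    simp only [← smul_sub, innerSL_apply_apply, inner_smul_right, sub_self, inner_zero_right] at h1
    exact h1)
  exact congrFun this k

lemma IsCoeff.add {a b : CoeffSpace m E} {f g : polydisc m → E}
    (ha : IsCoeff a f) (hb : IsCoeff b g) : IsCoeff (a + b) (f + g) := fun z => by
  simpa [smul_add] using (ha z).add (hb z)

lemma IsCoeff.smul {a : CoeffSpace m E} {f : polydisc m → E} (c : ℂ)
    (ha : IsCoeff a f) : IsCoeff (c • a) (c • f) := fun z => by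
  simpa [smul_comm c] using (ha z).const_smul c

lemma IsCoeff.zero : IsCoeff (0 : CoeffSpace m E) (0 : polydisc m → E) := fun z => by
  simp

variable (m E) in
/-- The functions on the polydisc that have a power series expansion with square-summable
coefficients. -/
def hardySubmodule : Submodule ℂ (polydisc m → E) where
  carrier := {f | ∃ a : CoeffSpace m E, IsCoeff a f}
  add_mem' := fun ⟨a, ha⟩ ⟨b, hb⟩ => ⟨a + b, ha.add hb⟩
  zero_mem' := ⟨0, IsCoeff.zero⟩
  smul_mem' := fun c _ ⟨a, ha⟩ => ⟨c • a, ha.smul c⟩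

variable (m E) in
/-- The Hardy space `H²_E(𝔻^m)`: the `E`-valued functions `f(z) = ∑ z^k a_k` on the polydisc with
`∑ ‖a_k‖² < ∞`, with the inner product `⟪f, g⟫ = ∑ ⟪a_k, b_k⟫`. -/
def HardySpace : Type _ := hardySubmodule m E

namespace HardySpace

instance : AddCommGroup (HardySpace m E) := inferInstanceAs (AddCommGroup (hardySubmodule m E))

instance : Module ℂ (HardySpace m E) := inferInstanceAs (Module ℂ (hardySubmodule m E))

instance : CoeFun (HardySpace m E) (fun _ => polydisc m → E) := ⟨fun f => f.1⟩

/-- The power series coefficients of an element of the Hardy space. -/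
def coeff : HardySpace m E →ₗ[ℂ] CoeffSpace m E where
  toFun f := f.2.choose
  map_add' f g := ((f + g).2.choose_spec).unique (f.2.choose_spec.add g.2.choose_spec)
  map_smul' c f := ((c • f).2.choose_spec).unique (f.2.choose_spec.smul c)

lemma isCoeff_coeff (f : HardySpace m E) : IsCoeff (coeff f) f := f.2.choose_spec

lemma coeff_injective : Function.Injective (coeff : HardySpace m E →ₗ[ℂ] CoeffSpace m E) := by
  intro f g h
  apply Subtype.ext
  funext z
  have hf := isCoeff_coeff f z
  rw [h] at hf
  exact hf.unique (isCoeff_coeff g z)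

instance : NormedAddCommGroup (HardySpace m E) :=
  NormedAddCommGroup.induced (HardySpace m E) (CoeffSpace m E) coeff coeff_injective

instance : InnerProductSpace ℂ (HardySpace m E) where
  norm_smul_le c f := by
    change ‖coeff (c • f)‖ ≤ ‖c‖ * ‖coeff f‖
    rw [map_smul, norm_smul]
  inner f g := ⟪coeff f, coeff g⟫_ℂ
  norm_sq_eq_re_inner f := InnerProductSpace.norm_sq_eq_re_inner (𝕜 := ℂ) (coeff f)
  conj_inner_symm f g := inner_conj_symm (𝕜 := ℂ) (coeff f) (coeff g)
  add_left f g h := by rw [map_add, inner_add_left]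
  smul_left f g c := by rw [map_smul, inner_smul_left]

lemma isCoeff_single (k : Fin m → ℕ) (η : E) :
    IsCoeff (lp.single 2 k η : CoeffSpace m E) (fun z => mpow z.1 k • η) := fun z => by
  have h := hasSum_single (f := fun j => mpow z.1 j • (lp.single 2 k η : CoeffSpace m E) j) k
    (fun j hj => by simp [Pi.single_eq_of_ne hj])
  simpa [lp.coeFn_single] using h

/-- The elementary tensor `z^k ⊗ η`, that is, the function `z ↦ z^k η`. -/
def monomial (k : Fin m → ℕ) (η : E) : HardySpace m E :=
  ⟨fun z => mpow z.1 k • η, lp.single 2 k η, isCoeff_single k η⟩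

/-- `(M_1, …, M_m)` is the operator-valued multishift with weights `Γ_{k,i}`: the weights are
uniformly bounded and `M_i (z^k ⊗ η) = z_i z^k ⊗ Γ_{k,i} η`. -/
def IsMultishift (Γ : (Fin m → ℕ) → Fin m → (E →L[ℂ] E))
    (M : Fin m → (HardySpace m E →L[ℂ] HardySpace m E)) : Prop :=
  (∃ C : ℝ, ∀ k i, ‖Γ k i‖ ≤ C) ∧
    ∀ i k η, M i (monomial k η) = monomial (k + Pi.single i 1) (Γ k i η)

/-- `M` is the block-diagonal operator with weights `Γ_k`: the weights are uniformly bounded and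
`M (z^k ⊗ η) = z^k ⊗ Γ_k η`. -/
def IsBlockDiagonal (Γ : (Fin m → ℕ) → (E →L[ℂ] E))
    (M : HardySpace m E →L[ℂ] HardySpace m E) : Prop :=
  (∃ C : ℝ, ∀ k, ‖Γ k‖ ≤ C) ∧ ∀ k η, M (monomial k η) = monomial k (Γ k η)

end HardySpace

end Hardy

/-! ### Doubly twisted near-isometries and their Wold-type decomposition -/

section Operators

variable {H : Type*} [NormedAddCommGroup H] [InnerProductSpace ℂ H]

/-- The (reducing) subspace `K` is of the form `⨁ T^n W` for a wandering subspace `W`, that is,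
the restriction of `T` to `K` is a shift. -/
def IsShiftOn (T : H →L[ℂ] H) (K : Submodule ℂ H) : Prop :=
  ∃ W : Submodule ℂ H, W ≤ K ∧ IsClosed (W : Set H) ∧
    (∀ i j : ℕ, i ≠ j → W.map (T ^ i).toLinearMap ⟂ W.map (T ^ j).toLinearMap) ∧
    (⨆ i : ℕ, W.map (T ^ i).toLinearMap).topologicalClosure = K

/-- The restriction of `T` to the subspace `K` is an invertible operator on `K`. For a closed
subspace `K` of a Hilbert space the inverse is automatically bounded. -/
def IsInvertibleOn (T : H →L[ℂ] H) (K : Submodule ℂ H) : Prop := Set.BijOn T K K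

/-- `S = Λ |S|` is the polar decomposition of `S : E → H`, where `Λ` is a unitary from `E` onto
the subspace `R` of `H`; the operator `P` is `|S| = (S* S)^{1/2}`. -/
def IsPolarUnitary {E : Type*} [NormedAddCommGroup E] [InnerProductSpace ℂ E]
    (S : E →L[ℂ] H) {R : Submodule ℂ H} (Λ : E ≃ₗᵢ[ℂ] R) : Prop :=
  ∃ P : E →L[ℂ] E, P.IsPositive ∧ (∀ x y, ⟪P (P x), y⟫_ℂ = ⟪S x, S y⟫_ℂ) ∧
    ∀ x, (Λ (P x) : H) = S x

variable {n : ℕ}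

/-- `T_B^k = T_{b_1}^{k_1} ⋯ T_{b_m}^{k_m}` for `B = {b_1 < ⋯ < b_m}`. -/
def opPow (T : Fin n → (H →L[ℂ] H)) (B : Finset (Fin n)) (k : Fin B.card → ℕ) : H →L[ℂ] H :=
  (List.ofFn fun i => T (B.orderEmbOfFin rfl i) ^ k i).prod

variable [CompleteSpace H]

/-- Near-isometries. -/
structure IsNearIsometry (T : H →L[ℂ] H) : Prop where
  bounds : ∃ δ : ℝ, 0 < δ ∧ ∀ x, δ * ‖x‖ ≤ ‖T x‖ ∧ ‖T x‖ ≤ ‖x‖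
  range_le : ∀ (p : ℕ) (x : H), ∃ y, ((T.adjoint) ^ p) ((T ^ (p + 1)) x) = T y

/-- `T` is a doubly twisted near-isometry with respect to the commuting unitaries `U i j`,
`i < j` (the values of `U` at the other pairs play no role). -/
structure IsDoublyTwisted (U : Fin n → Fin n → (H →L[ℂ] H)) (T : Fin n → (H →L[ℂ] H)) :
    Prop where
  unitary : ∀ i j, i < j → U i j ∈ unitary (H →L[ℂ] H)
  commute : ∀ i j p q, i < j → p < q → U i j * U p q = U p q * U i j
  nearIsometry : ∀ i, IsNearIsometry (T i)
  adjoint_mul : ∀ i j, i < j → (T i).adjoint * T j = (U i j).adjoint * T j * (T i).adjoint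
  mul_unitary : ∀ i j k, i < j → T k * U i j = U i j * T k
  mul_mul : ∀ i j, i < j → T i * T j = U i j * T j * T i

/-- `W_A`, the intersection of the kernels of `T_i*`, `i ∈ A`. -/
def kerSubspace (T : Fin n → (H →L[ℂ] H)) (A : Finset (Fin n)) : Submodule ℂ H :=
  ⨅ i ∈ A, (T i).adjoint.ker

/-- The `A`-wandering subspace `D_A = ⋂_ℓ T_{I∖A}^ℓ W_A`. -/
def wandering (T : Fin n → (H →L[ℂ] H)) (A : Finset (Fin n)) : Submodule ℂ H :=
  ⨅ l : Fin Aᶜ.card → ℕ, (kerSubspace T A).map (opPow T Aᶜ l).toLinearMap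

/-- The subspace `T_A^k D_A`. -/
def block (T : Fin n → (H →L[ℂ] H)) (A : Finset (Fin n)) (k : Fin A.card → ℕ) :
    Submodule ℂ H :=
  (wandering T A).map (opPow T A k).toLinearMap

/-- The Wold summand `H_A = ⨁_k T_A^k D_A`. -/
def woldSummand (T : Fin n → (H →L[ℂ] H)) (A : Finset (Fin n)) : Submodule ℂ H :=
  (⨆ k, block T A k).topologicalClosure

/-- The family `K` of closed subspaces is a Wold-type decomposition for `T`. -/
structure IsWoldDecomposition (T : Fin n → (H →L[ℂ] H))
    (K : Finset (Fin n) → Submodule ℂ H) : Prop where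
  closed : ∀ A, IsClosed (K A : Set H)
  reducing : ∀ A i, ∀ x ∈ K A, T i x ∈ K A ∧ (T i).adjoint x ∈ K A
  orthogonal : ∀ A B, A ≠ B → K A ⟂ K B
  span : ⨆ A, K A = ⊤
  shift : ∀ A, ∀ i ∈ A, IsShiftOn (T i) (K A)
  invertible : ∀ A, ∀ i ∉ A, IsInvertibleOn (T i) (K A)

variable (T : Fin n → (H →L[ℂ] H)) (A : Finset (Fin n))

/-- `T_A^k η` as an element of `T_A^k D_A`. -/
def toBlock (k : Fin A.card → ℕ) (η : wandering T A) : block T A k :=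
  ⟨opPow T A k η, Submodule.mem_map_of_mem η.2⟩

lemma block_le_woldSummand (k : Fin A.card → ℕ) : block T A k ≤ woldSummand T A :=
  (le_iSup (block T A) k).trans (Submodule.le_topologicalClosure _)

/-- `T_A^k η` as an element of `H_A`. -/
def toSummand (k : Fin A.card → ℕ) (η : wandering T A) : woldSummand T A :=
  ⟨opPow T A k η, block_le_woldSummand T A k (toBlock T A k η).2⟩

variable {T A}

/-- The operator `Λ_l* S Λ_k` on `D_A`, for an operator `S` that maps `T_A^k D_A` into
`T_A^l D_A`; here `Λ_l* = Λ_l⁻¹ : T_A^l D_A → D_A`. -/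
def weight (Λ : ∀ k, wandering T A ≃ₗᵢ[ℂ] block T A k) (S : H →L[ℂ] H)
    (k l : Fin A.card → ℕ) (h : Set.MapsTo S (block T A k) (block T A l)) :
    wandering T A →L[ℂ] wandering T A :=
  ((Λ l).symm : block T A l →L[ℂ] wandering T A) ∘L S.restrict h ∘L
    (Λ k : wandering T A →L[ℂ] block T A k)

end Operators

end NearIsom

end

/-!
For a near-isometry `S` the levels `S^p ker S*` are mutually orthogonal, because
`S*^p S^(p+1) H ⊆ S H`; the orthogonal complement of their closed span is the hyperrange `⋂ S^p H`,
and `S` is a shift on the span and invertible on the hyperrange. If `S'` doubly commutes with `S` up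
to a unitary commuting with both, then `S'` reduces every level of `S`. Hence, for a doubly twisted
tuple, the orthogonal projections onto a reducing subspace of `T_i` preserve the levels of `T_i`, so
that subspace is the sum of its intersections with the shift part and the hyperrange of `T_i`.
Iterating over `i` decomposes `H` into the subspaces `⋂_{i ∈ A} shift part ∩ ⋂_{i ∉ A} hyperrange`.
Since all `T_i` are injective, `T_A^k` maps the hyperranges and kernels that define `D_A` onto
`⋂_{i ∉ A} hyperrange ∩ ⋂_{i ∈ A} T_i^{k_i} ker T_i*`. So the block `T_A^k D_A` is this
intersection, the blocks are mutually orthogonal, and their closed span is the summand of `A`.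

As `T_A^k` is bounded below, its polar decomposition provides a unitary `Λ_{A,k}` from `D_A` onto
the block, and `z^k ⊗ η ↦ Λ_{A,k} η` extends to a unitary from the Hardy space onto `H_A`. The
weights of the model are the operators `T_s` between blocks, read through these unitaries.
-/

noncomputable section

namespace NearIsom

open ContinuousLinearMap Submodule

section Reducing

variable {𝕜 H : Type*} [RCLike 𝕜] [NormedAddCommGroup H] [InnerProductSpace 𝕜 H]

lemma inf_topologicalClosure_iSup {ι : Sort*} {K : Submodule 𝕜 H} [K.HasOrthogonalProjection]
    {L : ι → Submodule 𝕜 H}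
    (h : ∀ p, ∀ x ∈ L p, K.starProjection x ∈ L p) :
    K ⊓ (⨆ p, L p).topologicalClosure = (⨆ p, K ⊓ L p).topologicalClosure := by
  have hK : IsClosed (K : Set H) := K.orthogonal_orthogonal ▸ Kᗮ.isClosed_orthogonal
  refine le_antisymm (fun x hx => ?_) (le_inf ?_ ?_)
  · have hle : (⨆ p, L p).topologicalClosure ≤
        (⨆ p, K ⊓ L p).topologicalClosure.comap K.starProjection.toLinearMap :=
      topologicalClosure_minimal _
        (iSup_le fun p y hy => le_topologicalClosure _ <|
          mem_iSup_of_mem p ⟨K.starProjection_apply_mem y, h p y hy⟩)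
        ((isClosed_topologicalClosure _).preimage K.starProjection.continuous)
    simpa only [mem_comap, coe_coe, starProjection_eq_self_iff.mpr hx.1] using hle hx.2
  · exact topologicalClosure_minimal _ (iSup_le fun p => inf_le_left) hK
  · exact topologicalClosure_mono (iSup_mono fun p => inf_le_right)

variable [CompleteSpace H]

/-- The closed subspace `K` reduces the operator `S`: it is invariant under `S` and `S*`. -/
structure Reduces (S : H →L[𝕜] H) (K : Submodule 𝕜 H) : Prop where
  isClosed : IsClosed (K : Set H)
  map_mem : ∀ x ∈ K, S x ∈ K
  adjoint_mem : ∀ x ∈ K, S.adjoint x ∈ K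

namespace Reduces

variable {S : H →L[𝕜] H} {K L : Submodule 𝕜 H}

lemma hasOrthogonalProjection (h : Reduces S K) : K.HasOrthogonalProjection :=
  have : CompleteSpace K := h.isClosed.completeSpace_coe
  inferInstance

lemma adjoint (h : Reduces S K) : Reduces S.adjoint K :=
  ⟨h.isClosed, h.adjoint_mem, by simpa only [adjoint_adjoint] using h.map_mem⟩

lemma orthogonal (h : Reduces S K) : Reduces S Kᗮ where
  isClosed := K.isClosed_orthogonal
  map_mem := orthogonal_mem_invtSubmodule h.adjoint_mem
  adjoint_mem := orthogonal_mem_invtSubmodule h.adjoint.adjoint_mem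

lemma of_forall_mem (hK : IsClosed (K : Set H)) (h : ∀ x ∈ K, S x ∈ K)
    (h' : ∀ x ∈ Kᗮ, S x ∈ Kᗮ) : Reduces S K :=
  have : CompleteSpace K := hK.completeSpace_coe
  ⟨hK, h, mem_invtSubmodule_adjoint_iff.mpr h'⟩

lemma inf (hK : Reduces S K) (hL : Reduces S L) : Reduces S (K ⊓ L) where
  isClosed := hK.isClosed.inter hL.isClosed
  map_mem x hx := ⟨hK.map_mem x hx.1, hL.map_mem x hx.2⟩
  adjoint_mem x hx := ⟨hK.adjoint_mem x hx.1, hL.adjoint_mem x hx.2⟩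

lemma iInf {ι : Sort*} {K : ι → Submodule 𝕜 H} (h : ∀ i, Reduces S (K i)) :
    Reduces S (⨅ i, K i) where
  isClosed := by
    rw [coe_iInf]
    exact isClosed_iInter fun i => (h i).isClosed
  map_mem x hx := (mem_iInf _).mpr fun i => (h i).map_mem x ((mem_iInf _).mp hx i)
  adjoint_mem x hx := (mem_iInf _).mpr fun i => (h i).adjoint_mem x ((mem_iInf _).mp hx i)

lemma topologicalClosure_iSup {ι : Type*} {K : ι → Submodule 𝕜 H}
    (h : ∀ i, Reduces S (K i)) : Reduces S (⨆ i, K i).topologicalClosure := by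
  rw [← orthogonal_orthogonal_eq_closure, ← iInf_orthogonal]
  exact (iInf fun i => (h i).orthogonal).orthogonal

lemma commute_starProjection [K.HasOrthogonalProjection] (h : Reduces S K) :
    Commute K.starProjection S := by
  rw [K.isIdempotentElem_starProjection.commute_iff, range_starProjection, ker_starProjection]
  exact ⟨h.map_mem, h.orthogonal.map_mem⟩

lemma pow_mem (h : Reduces S K) (p : ℕ) : ∀ x ∈ K, (S ^ p) x ∈ K := by
  rw [FunLike.coe_pow_eq_iterate]
  exact Set.MapsTo.iterate h.map_mem p

lemma mem_of_pow_mem (h : Reduces S K) (hS : Function.Injective S) {p : ℕ} {x : H}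
    (hx : (S ^ p) x ∈ K) : x ∈ K := by
  have := h.hasOrthogonalProjection
  have hinj : Function.Injective (S ^ p) := FunLike.coe_pow_eq_iterate S p ▸ hS.iterate p
  refine starProjection_eq_self_iff.mp (hinj ?_)
  calc (S ^ p) (K.starProjection x) = K.starProjection ((S ^ p) x) :=
        (DFunLike.congr_fun (h.commute_starProjection.pow_right p) x).symm
    _ = (S ^ p) x := starProjection_eq_self_iff.mpr hx

end Reduces

end Reducing

section Hyperrange

variable {𝕜 E : Type*} [NontriviallyNormedField 𝕜] [NormedAddCommGroup E] [NormedSpace 𝕜 E]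
  {R T : E →L[𝕜] E}

lemma exists_antilipschitzWith_pow (hT : ∃ c, AntilipschitzWith c T) (p : ℕ) :
    ∃ c, AntilipschitzWith c (T ^ p) := by
  induction p with
  | zero => exact ⟨1, AntilipschitzWith.id⟩
  | succ p ih =>
    obtain ⟨c, hc⟩ := hT
    obtain ⟨d, hd⟩ := ih
    exact ⟨_, hd.comp hc⟩

lemma isClosed_map_of_antilipschitz [CompleteSpace E] {F : Type*} [NormedAddCommGroup F]
    [NormedSpace 𝕜 F] {S : E →L[𝕜] F} (hS : ∃ c, AntilipschitzWith c S) {K : Submodule 𝕜 E}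
    (hK : IsClosed (K : Set E)) : IsClosed (K.map S.toLinearMap : Set F) :=
  (hS.choose_spec.isClosedEmbedding S.uniformContinuous).isClosedMap _ hK

/-- The hyperrange of `T`, the intersection of the ranges of its powers: the candidate for the
invertible part of `T`. -/
def hyperrange (T : E →L[𝕜] E) : Submodule 𝕜 E := ⨅ p : ℕ, (T ^ p).range

lemma map_mem_hyperrange_of_commute (h : Commute R T) :
    ∀ x ∈ hyperrange T, R x ∈ hyperrange T := by
  intro x hx
  refine (mem_iInf _).mpr fun p => ?_
  obtain ⟨y, rfl⟩ := (mem_iInf _).mp hx p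
  exact ⟨R y, DFunLike.congr_fun (h.pow_right p).symm y⟩

end Hyperrange

section WoldRegular

variable {𝕜 H : Type*} [RCLike 𝕜] [NormedAddCommGroup H] [InnerProductSpace 𝕜 H]
  [CompleteSpace H]

/-- The subspace `T^p ker T*`, the `p`-th level of the shift part of `T`. -/
def level (T : H →L[𝕜] H) (p : ℕ) : Submodule 𝕜 H := T.adjoint.ker.map (T ^ p).toLinearMap

/-- The shift part of `T`, the closed span of the levels `T^p ker T*`. -/
def shiftPart (T : H →L[𝕜] H) : Submodule 𝕜 H := (⨆ p, level T p).topologicalClosure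

/-- The operators with a Wold decomposition into a shift and an invertible operator: those
bounded below for which every level is orthogonal to the range of the next power. For `T` bounded
below, the second condition says that `T*^p T^(p+1) H ⊆ T H` for all `p`. -/
structure IsWoldRegular (T : H →L[𝕜] H) : Prop where
  antilipschitz : ∃ c, AntilipschitzWith c T
  level_isOrtho_range : ∀ p, level T p ⟂ (T ^ (p + 1)).range

variable {R T : H →L[𝕜] H} {K : Submodule 𝕜 H}

lemma level_zero : level T 0 = T.adjoint.ker := map_id _

lemma level_le_shiftPart (p : ℕ) : level T p ≤ shiftPart T :=
  (le_iSup (level T) p).trans (le_topologicalClosure _)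

lemma map_mem_level_succ {p : ℕ} : ∀ x ∈ level T p, T x ∈ level T (p + 1) := by
  rintro _ ⟨w, hw, rfl⟩
  exact ⟨w, hw, by rw [pow_succ']; rfl⟩

lemma map_mem_level_of_commute (h : Commute R T) (h' : Commute R T.adjoint) (p : ℕ) :
    ∀ x ∈ level T p, R x ∈ level T p := by
  rintro _ ⟨w, hw, rfl⟩
  refine ⟨R w, ?_, DFunLike.congr_fun (h.pow_right p).symm w⟩
  calc T.adjoint (R w) = R (T.adjoint w) := DFunLike.congr_fun h'.symm w
    _ = 0 := by rw [show T.adjoint w = 0 from hw, map_zero]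

lemma map_mem_shiftPart_of_commute (h : Commute R T) (h' : Commute R T.adjoint) :
    ∀ x ∈ shiftPart T, R x ∈ shiftPart T :=
  show shiftPart T ≤ (shiftPart T).comap R.toLinearMap from
  topologicalClosure_minimal _
    (iSup_le fun p x hx => level_le_shiftPart p (map_mem_level_of_commute h h' p x hx))
    ((isClosed_topologicalClosure _).preimage R.continuous)

lemma Reduces.inf_shiftPart (hK : Reduces T K) :
    K ⊓ shiftPart T = (⨆ p, K ⊓ level T p).topologicalClosure :=
  have := hK.hasOrthogonalProjection
  inf_topologicalClosure_iSup <|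
    map_mem_level_of_commute hK.commute_starProjection hK.adjoint.commute_starProjection

namespace IsWoldRegular

lemma injective (hT : IsWoldRegular T) : Function.Injective T :=
  hT.antilipschitz.choose_spec.injective

lemma isClosed_level (hT : IsWoldRegular T) (p : ℕ) : IsClosed (level T p : Set H) :=
  isClosed_map_of_antilipschitz (exists_antilipschitzWith_pow hT.antilipschitz p)
    T.adjoint.isClosed_ker

lemma isClosed_range (hT : IsWoldRegular T) : IsClosed (T.range : Set H) := by
  have := isClosed_map_of_antilipschitz hT.antilipschitz (K := ⊤) isClosed_univ
  rwa [Submodule.map_top] at this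

lemma level_isOrtho_of_lt (hT : IsWoldRegular T) {p q : ℕ} (hpq : p < q) :
    level T p ⟂ level T q := by
  obtain ⟨r, rfl⟩ := Nat.exists_eq_add_of_lt hpq
  refine (hT.level_isOrtho_range p).mono_right ?_
  rintro _ ⟨w, -, rfl⟩
  refine ⟨(T ^ r) w, ?_⟩
  rw [show p + r + 1 = (p + 1) + r by ring, pow_add T (p + 1)]
  rfl

lemma level_isOrtho (hT : IsWoldRegular T) {p q : ℕ} (hpq : p ≠ q) : level T p ⟂ level T q :=
  hpq.lt_or_gt.elim hT.level_isOrtho_of_lt fun h => (hT.level_isOrtho_of_lt h).symm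

lemma range_pow_le (hT : IsWoldRegular T) (p : ℕ) :
    (T ^ p).range ≤ level T p ⊔ (T ^ (p + 1)).range := by
  have : CompleteSpace T.range := hT.isClosed_range.completeSpace_coe
  rintro _ ⟨x, rfl⟩
  obtain ⟨_, ⟨y, rfl⟩, w, hw, rfl⟩ := T.range.exists_add_mem_mem_orthogonal x
  rw [orthogonal_range] at hw
  rw [map_add, sup_comm]
  exact add_mem_sup ⟨y, by rw [pow_succ]; rfl⟩ ⟨w, hw, rfl⟩

-- An element of `T^p H` orthogonal to the `p`-th level lies in `T^(p+1) H`.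
lemma hyperrange_eq (hT : IsWoldRegular T) : hyperrange T = (shiftPart T)ᗮ := by
  rw [shiftPart, orthogonal_closure, ← iInf_orthogonal]
  refine le_antisymm (le_iInf fun p => ?_) fun x hx => (mem_iInf _).mpr fun p => ?_
  · exact (iInf_le _ (p + 1)).trans (hT.level_isOrtho_range p).symm.le
  · induction p with
    | zero => exact ⟨x, rfl⟩
    | succ p ih =>
      obtain ⟨a, ha, b, hb, rfl⟩ := mem_sup.mp (hT.range_pow_le p ih)
      have hab : a + b ∈ (level T p)ᗮ := (mem_iInf _).mp hx p
      have hb' : b ∈ (level T p)ᗮ := (hT.level_isOrtho_range p).symm.le hb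
      have ha' : a ∈ (level T p)ᗮ := by simpa using sub_mem hab hb'
      rwa [disjoint_def.mp (orthogonal_disjoint _) a ha ha', zero_add]

lemma shiftPart_isOrtho_hyperrange (hT : IsWoldRegular T) : shiftPart T ⟂ hyperrange T := by
  rw [hT.hyperrange_eq]
  exact isOrtho_orthogonal_right _

lemma shiftPart_sup_hyperrange (hT : IsWoldRegular T) : shiftPart T ⊔ hyperrange T = ⊤ := by
  have : CompleteSpace (shiftPart T) := (isClosed_topologicalClosure _).completeSpace_coe
  rw [hT.hyperrange_eq, sup_orthogonal_of_hasOrthogonalProjection]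

lemma reduces_shiftPart (hT : IsWoldRegular T) : Reduces T (shiftPart T) := by
  refine .of_forall_mem (isClosed_topologicalClosure _) ?_ ?_
  · change shiftPart T ≤ (shiftPart T).comap T.toLinearMap
    exact topologicalClosure_minimal _
      (iSup_le fun p x hx => level_le_shiftPart (p + 1) (map_mem_level_succ x hx))
      ((isClosed_topologicalClosure _).preimage T.continuous)
  · rw [← hT.hyperrange_eq]
    exact map_mem_hyperrange_of_commute (Commute.refl T)

lemma reduces_hyperrange (hT : IsWoldRegular T) : Reduces T (hyperrange T) :=
  hT.hyperrange_eq ▸ hT.reduces_shiftPart.orthogonal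

lemma map_pow_inf_ker (hT : IsWoldRegular T) (hK : Reduces T K) (p : ℕ) :
    (K ⊓ T.adjoint.ker).map (T ^ p).toLinearMap = K ⊓ level T p := by
  apply le_antisymm
  · rintro _ ⟨w, ⟨hw, hw'⟩, rfl⟩
    exact ⟨hK.pow_mem p w hw, w, hw', rfl⟩
  · rintro _ ⟨hx, w, hw, rfl⟩
    exact ⟨w, ⟨hK.mem_of_pow_mem hT.injective hx, hw⟩, rfl⟩

lemma le_map_pow (hT : IsWoldRegular T) (hK : Reduces T K) (h : K ≤ hyperrange T) (p : ℕ) :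
    K ≤ K.map (T ^ p).toLinearMap := by
  intro x hx
  obtain ⟨y, rfl⟩ := (mem_iInf _).mp (h hx) p
  exact ⟨y, hK.mem_of_pow_mem hT.injective hx, rfl⟩

lemma le_inf_sup_inf (hT : IsWoldRegular T) (hK : Reduces T K) :
    K ≤ K ⊓ shiftPart T ⊔ K ⊓ hyperrange T := by
  intro x hx
  have := hK.hasOrthogonalProjection
  have hc := hK.commute_starProjection
  have hmem := K.starProjection_apply_mem
  obtain ⟨a, ha, b, hb, rfl⟩ := mem_sup.mp (hT.shiftPart_sup_hyperrange ▸ mem_top (x := x))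
  rw [← starProjection_eq_self_iff.mpr hx, map_add]
  exact add_mem_sup
    ⟨hmem a, map_mem_shiftPart_of_commute hc hK.adjoint.commute_starProjection a ha⟩
    ⟨hmem b, map_mem_hyperrange_of_commute hc b hb⟩

end IsWoldRegular

end WoldRegular

section WoldComplex

variable {H : Type*} [NormedAddCommGroup H] [InnerProductSpace ℂ H] [CompleteSpace H]
  {T : H →L[ℂ] H} {K : Submodule ℂ H}

lemma IsWoldRegular.isShiftOn (hT : IsWoldRegular T) (hK : Reduces T K) (h : K ≤ shiftPart T) :
    IsShiftOn T K := by
  refine ⟨K ⊓ T.adjoint.ker, inf_le_left, hK.isClosed.inter T.adjoint.isClosed_ker, ?_, ?_⟩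
  · intro p q hpq
    rw [hT.map_pow_inf_ker hK, hT.map_pow_inf_ker hK]
    exact (hT.level_isOrtho hpq).mono inf_le_right inf_le_right
  · simp_rw [hT.map_pow_inf_ker hK]
    rw [← hK.inf_shiftPart, inf_eq_left.mpr h]

lemma IsWoldRegular.isInvertibleOn (hT : IsWoldRegular T) (hK : Reduces T K)
    (h : K ≤ hyperrange T) : IsInvertibleOn T K :=
  ⟨hK.map_mem, hT.injective.injOn, by
    have := hT.le_map_pow hK h 1
    rwa [pow_one] at this⟩

lemma IsNearIsometry.exists_antilipschitzWith (hT : IsNearIsometry T) :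
    ∃ c, AntilipschitzWith c T := by
  obtain ⟨δ, hδ, h⟩ := hT.bounds
  refine ⟨δ⁻¹.toNNReal, antilipschitz_of_bound _ fun x => ?_⟩
  rw [Real.coe_toNNReal _ (by positivity), inv_mul_eq_div, le_div_iff₀' hδ]
  exact (h x).1

lemma IsNearIsometry.isWoldRegular (hT : IsNearIsometry T) : IsWoldRegular T where
  antilipschitz := hT.exists_antilipschitzWith
  level_isOrtho_range p := by
    rw [isOrtho_iff_inner_eq]
    rintro _ ⟨w, hw, rfl⟩ _ ⟨x, rfl⟩
    obtain ⟨y, hy⟩ := hT.range_le p x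
    have hstar : (T.adjoint ^ p : H →L[ℂ] H) = (T ^ p).adjoint := (star_pow T p).symm
    calc ⟪(T ^ p) w, (T ^ (p + 1)) x⟫_ℂ = ⟪w, (T.adjoint ^ p) ((T ^ (p + 1)) x)⟫_ℂ := by
          rw [hstar, adjoint_inner_right]
      _ = ⟪T.adjoint w, y⟫_ℂ := by rw [hy, adjoint_inner_left]
      _ = 0 := by rw [show T.adjoint w = 0 from hw, inner_zero_left]

end WoldComplex

section PowProd

variable {M : Type*} [Monoid M] {m : ℕ}

/-- The ordered product `S_1^{k_1} ⋯ S_m^{k_m}`; `opPow T B k` is the case of the subfamily of `T`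
enumerated by `B`. -/
def powProd (S : Fin m → M) (k : Fin m → ℕ) : M := (List.ofFn fun i => S i ^ k i).prod

lemma powProd_succ (S : Fin (m + 1) → M) (k : Fin (m + 1) → ℕ) :
    powProd S k = S 0 ^ k 0 * powProd (S ∘ Fin.succ) (k ∘ Fin.succ) := by
  simp only [powProd, List.ofFn_succ, List.prod_cons, Function.comp_apply]

lemma powProd_zero (S : Fin m → M) : powProd S 0 = 1 := by
  simp [powProd]

lemma powProd_single (S : Fin m → M) (i : Fin m) (p : ℕ) : powProd S (Pi.single i p) = S i ^ p := by
  induction m with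
  | zero => exact i.elim0
  | succ m ih =>
    rw [powProd_succ]
    cases i using Fin.cases with
    | zero =>
      have htail : (Pi.single 0 p : Fin (m + 1) → ℕ) ∘ Fin.succ = 0 := by
        ext j
        simp
      rw [htail, powProd_zero, mul_one, Pi.single_eq_same]
    | succ i =>
      have htail : (Pi.single i.succ p : Fin (m + 1) → ℕ) ∘ Fin.succ = Pi.single i p := by
        ext j
        simp [Pi.single_apply]
      rw [htail, ih, Pi.single_eq_of_ne (Fin.succ_ne_zero i).symm, pow_zero, one_mul,
        Function.comp_apply]

end PowProd

section PowProdOperators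

variable {𝕜 E : Type*} [NontriviallyNormedField 𝕜] [NormedAddCommGroup E] [NormedSpace 𝕜 E] {m : ℕ}
  {S : Fin m → (E →L[𝕜] E)}

lemma exists_antilipschitzWith_powProd (hS : ∀ i, ∃ c, AntilipschitzWith c (S i))
    (k : Fin m → ℕ) : ∃ c, AntilipschitzWith c (powProd S k : E →L[𝕜] E) := by
  induction m with
  | zero => exact ⟨1, AntilipschitzWith.id⟩
  | succ m ih =>
    obtain ⟨c, hc⟩ := exists_antilipschitzWith_pow (hS 0) (k 0)
    obtain ⟨d, hd⟩ := ih (fun i => hS i.succ) (k ∘ Fin.succ)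
    rw [powProd_succ]
    exact ⟨_, hc.comp hd⟩

lemma le_map_powProd {K : Submodule 𝕜 E}
    (hK : ∀ i p, K ≤ K.map (S i ^ p).toLinearMap) (k : Fin m → ℕ) :
    K ≤ K.map (powProd S k).toLinearMap := by
  induction m with
  | zero =>
    rw [Subsingleton.elim k 0, powProd_zero]
    exact (Submodule.map_id K).ge
  | succ m ih =>
    intro x hx
    obtain ⟨y, hy, rfl⟩ := hK 0 (k 0) hx
    obtain ⟨z, hz, rfl⟩ := ih (fun i => hK i.succ) (k ∘ Fin.succ) hy
    exact ⟨z, hz, by rw [powProd_succ]; rfl⟩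

lemma iInf_map_powProd_le (K : Submodule 𝕜 E) :
    ⨅ k, K.map (powProd S k).toLinearMap ≤ K ⊓ ⨅ i, hyperrange (S i) := by
  refine le_inf ((iInf_le _ 0).trans ?_) (le_iInf fun i => le_iInf fun p => ?_)
  · rw [powProd_zero]
    exact (Submodule.map_id K).le
  · refine (iInf_le _ (Pi.single i p)).trans ?_
    rw [powProd_single]
    exact LinearMap.map_le_range

end PowProdOperators

section WoldFamily

lemma iInf_fin_succ {α : Type*} [CompleteLattice α] {m : ℕ} (f : Fin (m + 1) → α) :
    ⨅ i, f i = f 0 ⊓ ⨅ i : Fin m, f i.succ :=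
  eq_of_forall_le_iff fun a => by simp only [le_iInf_iff, le_inf_iff, Fin.forall_fin_succ]

lemma iInf_orderEmbOfFin {α β : Type*} [LinearOrder α] [CompleteLattice β] (s : Finset α)
    (f : α → β) : ⨅ r, f (s.orderEmbOfFin rfl r) = ⨅ i ∈ s, f i := by
  rw [← iInf_range (g := f) (f := s.orderEmbOfFin rfl), Finset.range_orderEmbOfFin]
  rfl

variable {𝕜 H ι : Type*} [RCLike 𝕜] [NormedAddCommGroup H] [InnerProductSpace 𝕜 H]
  [CompleteSpace H]

/-- A family of operators with a joint Wold decomposition: each operator is regular in the sense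
of `IsWoldRegular`, and the levels of each one reduce all the others. -/
structure IsWoldFamily (T : ι → (H →L[𝕜] H)) : Prop where
  isWoldRegular : ∀ i, IsWoldRegular (T i)
  reduces_level : ∀ i j, i ≠ j → ∀ p, Reduces (T j) (level (T i) p)

/-- The intersection of the hyperranges of the `T i`, `i ∈ B`. -/
def jointHyperrange (T : ι → (H →L[𝕜] H)) (B : Finset ι) : Submodule 𝕜 H :=
  ⨅ i ∈ B, hyperrange (T i)

/-- The part of the Wold decomposition of `T i` that contributes to the summand indexed by `A`:
the shift part if `i ∈ A` and the hyperrange otherwise. -/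
def woldPart [DecidableEq ι] (T : ι → (H →L[𝕜] H)) (A : Finset ι) (i : ι) : Submodule 𝕜 H :=
  if i ∈ A then shiftPart (T i) else hyperrange (T i)

lemma iInf_woldPart [Fintype ι] [DecidableEq ι] (T : ι → (H →L[𝕜] H)) (A : Finset ι) :
    ⨅ i, woldPart T A i = jointHyperrange T Aᶜ ⊓ ⨅ i ∈ A, shiftPart (T i) := by
  simp only [woldPart, iInf_ite, jointHyperrange, Finset.mem_compl, inf_comm]

namespace IsWoldFamily

variable {T : ι → (H →L[𝕜] H)} {K : Submodule 𝕜 H}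

lemma comp {κ : Type*} (hT : IsWoldFamily T) {e : κ → ι} (he : Function.Injective e) :
    IsWoldFamily (T ∘ e) :=
  ⟨fun i => hT.isWoldRegular (e i), fun _ _ hij => hT.reduces_level _ _ (he.ne hij)⟩

lemma reduces_ker (hT : IsWoldFamily T) {i j : ι} (hij : i ≠ j) :
    Reduces (T j) (T i).adjoint.ker :=
  level_zero (T := T i) ▸ hT.reduces_level i j hij 0

lemma reduces_shiftPart (hT : IsWoldFamily T) (i j : ι) : Reduces (T j) (shiftPart (T i)) := by
  rcases eq_or_ne i j with rfl | hij
  · exact (hT.isWoldRegular i).reduces_shiftPart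
  · exact .topologicalClosure_iSup (hT.reduces_level i j hij)

lemma reduces_hyperrange (hT : IsWoldFamily T) (i j : ι) : Reduces (T j) (hyperrange (T i)) :=
  (hT.isWoldRegular i).hyperrange_eq ▸ (hT.reduces_shiftPart i j).orthogonal

lemma reduces_jointHyperrange (hT : IsWoldFamily T) (B : Finset ι) (j : ι) :
    Reduces (T j) (jointHyperrange T B) :=
  .iInf fun i => .iInf fun _ => hT.reduces_hyperrange i j

lemma isClosed_jointHyperrange (hT : IsWoldFamily T) (B : Finset ι) :
    IsClosed (jointHyperrange T B : Set H) := by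
  simp only [jointHyperrange, coe_iInf]
  exact isClosed_biInter fun i _ => (hT.reduces_hyperrange i i).isClosed

lemma reduces_woldPart [DecidableEq ι] (hT : IsWoldFamily T) (A : Finset ι) (i j : ι) :
    Reduces (T j) (woldPart T A i) := by
  rw [woldPart]
  split_ifs
  exacts [hT.reduces_shiftPart i j, hT.reduces_hyperrange i j]

lemma map_powProd {m : ℕ} {S : Fin m → (H →L[𝕜] H)} (hS : IsWoldFamily S)
    (hK : ∀ i, Reduces (S i) K) (k : Fin m → ℕ) :
    (K ⊓ ⨅ i, (S i).adjoint.ker).map (powProd S k).toLinearMap = K ⊓ ⨅ i, level (S i) (k i) := by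
  induction m generalizing K with
  | zero =>
    rw [Subsingleton.elim k 0, powProd_zero, iInf_of_empty, iInf_of_empty, inf_top_eq]
    exact Submodule.map_id K
  | succ m ih =>
    have htail := ih (hS.comp (Fin.succ_injective m)) (K := K ⊓ (S 0).adjoint.ker)
      (fun i => (hK i.succ).inf (hS.reduces_ker (Fin.succ_ne_zero i).symm)) (k ∘ Fin.succ)
    have hred : Reduces (S 0) (K ⊓ ⨅ i : Fin m, level (S i.succ) (k i.succ)) :=
      (hK 0).inf (.iInf fun i => hS.reduces_level _ _ (Fin.succ_ne_zero i) _)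
    have hhead := (hS.isWoldRegular 0).map_pow_inf_ker hred (k 0)
    simp only [Function.comp_apply] at htail
    have hcomp : (powProd S k).toLinearMap =
        (S 0 ^ k 0).toLinearMap ∘ₗ (powProd (S ∘ Fin.succ) (k ∘ Fin.succ)).toLinearMap := by
      rw [powProd_succ]
      rfl
    rw [hcomp, Submodule.map_comp, iInf_fin_succ, iInf_fin_succ, ← inf_assoc, htail,
      inf_right_comm, hhead, inf_assoc, inf_comm (⨅ i : Fin m, _)]

lemma iInf_map_powProd {m : ℕ} {S : Fin m → (H →L[𝕜] H)} (hS : IsWoldFamily S)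
    (hK : ∀ i, Reduces (S i) K) :
    ⨅ k, K.map (powProd S k).toLinearMap = K ⊓ ⨅ i, hyperrange (S i) := by
  refine (iInf_map_powProd_le K).antisymm (le_iInf fun k => ?_)
  refine (le_map_powProd (fun i p => ?_) k).trans (Submodule.map_mono inf_le_left)
  exact (hS.isWoldRegular i).le_map_pow ((hK i).inf (.iInf fun j => hS.reduces_hyperrange j i))
    (inf_le_right.trans (iInf_le _ i)) p

lemma map_mem_iInf_level (hT : IsWoldFamily T) [DecidableEq ι] (k : ι → ℕ) (i : ι) :
    ∀ x ∈ ⨅ j, level (T j) (k j), T i x ∈ ⨅ j, level (T j) ((k + Pi.single i 1 : ι → ℕ) j) := by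
  intro x hx
  refine (mem_iInf _).mpr fun j => ?_
  have hxj := (mem_iInf _).mp hx j
  rcases eq_or_ne j i with rfl | hji
  · rw [Pi.add_apply, Pi.single_eq_same]
    exact map_mem_level_succ x hxj
  · rw [Pi.add_apply, Pi.single_eq_of_ne hji, add_zero]
    exact (hT.reduces_level j i hji _).map_mem x hxj

lemma iInf_level_isOrtho (hT : IsWoldFamily T) {k l : ι → ℕ} (hkl : k ≠ l) :
    ⨅ i, level (T i) (k i) ⟂ ⨅ i, level (T i) (l i) := by
  obtain ⟨i, hi⟩ := Function.ne_iff.mp hkl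
  exact ((hT.isWoldRegular i).level_isOrtho hi).mono (iInf_le _ i) (iInf_le _ i)

lemma inf_iInf_shiftPart_le (hT : IsWoldFamily T) (s : Finset ι) (hK : ∀ i, Reduces (T i) K) :
    K ⊓ ⨅ i ∈ s, shiftPart (T i) ≤
      (⨆ k : ι → ℕ, K ⊓ ⨅ i ∈ s, level (T i) (k i)).topologicalClosure := by
  classical
  induction s using Finset.induction_on generalizing K with
  | empty =>
    simp only [Finset.notMem_empty, iInf_false, iInf_top, inf_top_eq, ciSup_const]
    exact le_topologicalClosure _
  | insert i s hi ih =>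
    rw [Finset.iInf_insert, ← inf_assoc]
    refine (ih fun j => (hK j).inf (hT.reduces_shiftPart i j)).trans ?_
    refine topologicalClosure_minimal _ (iSup_le fun k => ?_) (isClosed_topologicalClosure _)
    have hred : Reduces (T i) (K ⊓ ⨅ j ∈ s, level (T j) (k j)) :=
      (hK i).inf <| .iInf fun j => .iInf fun hj =>
        hT.reduces_level j i (ne_of_mem_of_not_mem hj hi) _
    rw [inf_right_comm, hred.inf_shiftPart]
    refine topologicalClosure_mono (iSup_le fun p => le_iSup_of_le (Function.update k i p) ?_)
    rw [Finset.iInf_insert, Function.update_self, inf_assoc, inf_comm (⨅ j ∈ s, _)]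
    refine inf_le_inf_left _ (inf_le_inf_left _ (le_iInf₂ fun j hj => ?_))
    rw [Function.update_of_ne (ne_of_mem_of_not_mem hj hi)]
    exact iInf₂_le j hj

lemma closure_iSup_inf_iInf_level [Finite ι] (hT : IsWoldFamily T) (hK : ∀ i, Reduces (T i) K)
    (hcl : IsClosed (K : Set H)) :
    (⨆ k : ι → ℕ, K ⊓ ⨅ i, level (T i) (k i)).topologicalClosure =
      K ⊓ ⨅ i, shiftPart (T i) := by
  cases nonempty_fintype ι
  apply le_antisymm
  · refine topologicalClosure_minimal _ (iSup_le fun k => ?_) (hcl.inter ?_)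
    · exact inf_le_inf_left _ (iInf_mono fun i => level_le_shiftPart _)
    · rw [coe_iInf]
      exact isClosed_iInter fun i => isClosed_topologicalClosure _
  · simpa only [Finset.mem_univ, iInf_pos] using hT.inf_iInf_shiftPart_le Finset.univ hK

variable [DecidableEq ι]

lemma iInf_woldPart_isOrtho (hT : IsWoldFamily T) {A B : Finset ι} (hAB : A ≠ B) :
    ⨅ i, woldPart T A i ⟂ ⨅ i, woldPart T B i := by
  obtain ⟨i, hi⟩ : ∃ i, ¬(i ∈ A ↔ i ∈ B) := by
    by_contra! h
    exact hAB (Finset.ext h)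
  refine IsOrtho.mono (iInf_le _ i) (iInf_le _ i) ?_
  have hortho := (hT.isWoldRegular i).shiftPart_isOrtho_hyperrange
  rw [woldPart, woldPart]
  split_ifs with hA hB hB
  exacts [absurd (iff_of_true hA hB) hi, hortho, hortho.symm, absurd (iff_of_false hA hB) hi]

lemma iSup_iInf_woldPart (hT : IsWoldFamily T) (s : Finset ι) :
    ⨆ A : Finset ι, ⨅ i ∈ s, woldPart T A i = ⊤ := by
  induction s using Finset.induction_on with
  | empty => simp only [Finset.notMem_empty, iInf_false, iInf_top, ciSup_const]
  | insert i s hi ih =>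
    refine top_unique (ih.symm.le.trans (iSup_le fun A => ?_))
    have hcongr : ∀ B : Finset ι, (∀ j ∈ s, j ∈ B ↔ j ∈ A) →
        (⨅ j ∈ s, woldPart T A j) ⊓ woldPart T B i ≤
          ⨆ A : Finset ι, ⨅ j ∈ insert i s, woldPart T A j := by
      refine fun B hB => le_iSup_of_le B ?_
      rw [Finset.iInf_insert, inf_comm]
      exact inf_le_inf_left _ (iInf₂_mono fun j hj => by simp only [woldPart, hB j hj, le_refl])
    refine ((hT.isWoldRegular i).le_inf_sup_inf
      (.iInf fun j => .iInf fun _ => hT.reduces_woldPart A j i)).trans (sup_le ?_ ?_)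
    · have := hcongr (insert i A) fun j hj => by simp [ne_of_mem_of_not_mem hj hi]
      rwa [woldPart, if_pos (Finset.mem_insert_self i A)] at this
    · have := hcongr (A.erase i) fun j hj => by simp [ne_of_mem_of_not_mem hj hi]
      rwa [woldPart, if_neg (Finset.notMem_erase i A)] at this

end IsWoldFamily

end WoldFamily

section Summands

variable {n : ℕ} {H : Type*} [NormedAddCommGroup H] [InnerProductSpace ℂ H] [CompleteSpace H]
  {T : Fin n → (H →L[ℂ] H)}

namespace IsWoldFamily

lemma comp_orderEmbOfFin (hT : IsWoldFamily T) (A : Finset (Fin n)) :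
    IsWoldFamily (T ∘ A.orderEmbOfFin rfl) :=
  hT.comp (A.orderEmbOfFin rfl).injective

lemma wandering_eq (hT : IsWoldFamily T) (A : Finset (Fin n)) :
    wandering T A = jointHyperrange T Aᶜ ⊓ kerSubspace T A := by
  have hred : ∀ r, Reduces (T (Aᶜ.orderEmbOfFin rfl r)) (kerSubspace T A) := fun r =>
    .iInf fun i => .iInf fun hi => hT.reduces_ker <| ne_of_mem_of_not_mem hi <|
      Finset.mem_compl.mp (Aᶜ.orderEmbOfFin_mem rfl r)
  calc wandering T A = kerSubspace T A ⊓ ⨅ r, hyperrange (T (Aᶜ.orderEmbOfFin rfl r)) :=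
        (hT.comp_orderEmbOfFin Aᶜ).iInf_map_powProd hred
    _ = jointHyperrange T Aᶜ ⊓ kerSubspace T A := by
        rw [iInf_orderEmbOfFin Aᶜ fun i => hyperrange (T i), inf_comm, jointHyperrange]

lemma block_eq (hT : IsWoldFamily T) (A : Finset (Fin n)) (k : Fin A.card → ℕ) :
    block T A k = jointHyperrange T Aᶜ ⊓ ⨅ r, level (T (A.orderEmbOfFin rfl r)) (k r) := by
  rw [block, hT.wandering_eq, kerSubspace, ← iInf_orderEmbOfFin A fun i => (T i).adjoint.ker]
  exact (hT.comp_orderEmbOfFin A).map_powProd (fun r => hT.reduces_jointHyperrange Aᶜ _) k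

lemma woldSummand_eq (hT : IsWoldFamily T) (A : Finset (Fin n)) :
    woldSummand T A = ⨅ i, woldPart T A i := by
  simp_rw [woldSummand, hT.block_eq]
  rw [iInf_woldPart, ← iInf_orderEmbOfFin A fun i => shiftPart (T i)]
  exact (hT.comp_orderEmbOfFin A).closure_iSup_inf_iInf_level
    (fun r => hT.reduces_jointHyperrange Aᶜ _) (hT.isClosed_jointHyperrange Aᶜ)

lemma reduces_woldSummand (hT : IsWoldFamily T) (A : Finset (Fin n)) (j : Fin n) :
    Reduces (T j) (woldSummand T A) := by
  rw [hT.woldSummand_eq]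
  exact .iInf fun i => hT.reduces_woldPart A i j

theorem isWoldDecomposition (hT : IsWoldFamily T) : IsWoldDecomposition T (woldSummand T) where
  closed A := isClosed_topologicalClosure _
  reducing A i x hx :=
    ⟨(hT.reduces_woldSummand A i).map_mem x hx, (hT.reduces_woldSummand A i).adjoint_mem x hx⟩
  orthogonal A B hAB := by
    rw [hT.woldSummand_eq, hT.woldSummand_eq]
    exact hT.iInf_woldPart_isOrtho hAB
  span := by
    simp_rw [hT.woldSummand_eq]
    simpa only [Finset.mem_univ, iInf_pos] using hT.iSup_iInf_woldPart Finset.univ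
  shift A i hi := by
    refine (hT.isWoldRegular i).isShiftOn (hT.reduces_woldSummand A i) ?_
    rw [hT.woldSummand_eq]
    exact (iInf_le _ i).trans_eq (if_pos hi)
  invertible A i hi := by
    refine (hT.isWoldRegular i).isInvertibleOn (hT.reduces_woldSummand A i) ?_
    rw [hT.woldSummand_eq]
    exact (iInf_le _ i).trans_eq (if_neg hi)

variable (A : Finset (Fin n))

lemma mapsTo_block_succ (hT : IsWoldFamily T) (k : Fin A.card → ℕ) (r : Fin A.card) :
    Set.MapsTo (T (A.orderEmbOfFin rfl r)) (block T A k) (block T A (k + Pi.single r 1)) := by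
  intro x hx
  rw [SetLike.mem_coe, hT.block_eq] at hx ⊢
  exact ⟨(hT.reduces_jointHyperrange Aᶜ _).map_mem x hx.1,
    (hT.comp_orderEmbOfFin A).map_mem_iInf_level k r x hx.2⟩

lemma mapsTo_block (hT : IsWoldFamily T) (k : Fin A.card → ℕ) {s : Fin n} (hs : s ∉ A) :
    Set.MapsTo (T s) (block T A k) (block T A k) := by
  have hred : Reduces (T s) (block T A k) := by
    rw [hT.block_eq]
    exact (hT.reduces_jointHyperrange Aᶜ s).inf <| .iInf fun r => hT.reduces_level _ s
      (ne_of_mem_of_not_mem (A.orderEmbOfFin_mem rfl r) hs) _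
  exact hred.map_mem

lemma block_isOrtho (hT : IsWoldFamily T) {k l : Fin A.card → ℕ} (hkl : k ≠ l) :
    block T A k ⟂ block T A l := by
  rw [hT.block_eq, hT.block_eq]
  exact ((hT.comp_orderEmbOfFin A).iInf_level_isOrtho hkl).mono inf_le_right inf_le_right

lemma isClosed_wandering (hT : IsWoldFamily T) : IsClosed (wandering T A : Set H) := by
  rw [hT.wandering_eq, kerSubspace]
  simp only [coe_inf, coe_iInf]
  exact (hT.isClosed_jointHyperrange Aᶜ).inter
    (isClosed_biInter fun i _ => (T i).adjoint.isClosed_ker)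

end IsWoldFamily

end Summands

section Twisted

/-- The elements `a` and `b` doubly commute up to the unitary `u`, which commutes with both. This
is the relation between two members of a doubly twisted tuple. -/
structure IsTwistedPair {M : Type*} [Monoid M] [StarMul M] (u a b : M) : Prop where
  mem_unitary : u ∈ unitary M
  commute_left : Commute u a
  commute_right : Commute u b
  mul_eq : a * b = u * b * a
  star_mul_eq : star a * b = star u * b * star a

lemma commute_star_of_mem_unitary {M : Type*} [Monoid M] [StarMul M] {u a : M}
    (hu : u ∈ unitary M) (h : Commute u a) : Commute (star u) a :=
  Commute.units_inv_left (u := Unitary.toUnits ⟨u, hu⟩) h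

namespace IsTwistedPair

section Monoid

variable {M : Type*} [Monoid M] [StarMul M] {u a b : M}

lemma swap_mul_eq (h : IsTwistedPair u a b) : b * a = star u * a * b := by
  rw [mul_assoc, h.mul_eq, mul_assoc, ← mul_assoc (star u),
    Unitary.star_mul_self_of_mem h.mem_unitary, one_mul]

lemma star_mul_swap (h : IsTwistedPair u a b) : star b * a = u * a * star b := by
  have hstar := congrArg star h.star_mul_eq
  simp only [star_mul, star_star] at hstar
  have hcomm : Commute u (star b) := by
    simpa only [star_star] using
      (commute_star_of_mem_unitary h.mem_unitary h.commute_right).star_star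
  rw [hstar, ← hcomm.eq, ← mul_assoc, h.commute_left.eq]

lemma symm (h : IsTwistedPair u a b) : IsTwistedPair (star u) b a where
  mem_unitary := Unitary.star_mem h.mem_unitary
  commute_left := commute_star_of_mem_unitary h.mem_unitary h.commute_right
  commute_right := commute_star_of_mem_unitary h.mem_unitary h.commute_left
  mul_eq := h.swap_mul_eq
  star_mul_eq := by rw [star_star, h.star_mul_swap]

lemma star_left (h : IsTwistedPair u a b) : IsTwistedPair (star u) (star a) b where
  mem_unitary := Unitary.star_mem h.mem_unitary
  commute_left := h.commute_left.star_star
  commute_right := commute_star_of_mem_unitary h.mem_unitary h.commute_right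
  mul_eq := h.star_mul_eq
  star_mul_eq := by rw [star_star, star_star, h.mul_eq]

lemma star_right (h : IsTwistedPair u a b) : IsTwistedPair (star u) a (star b) := by
  simpa only [star_star] using h.symm.star_left.symm

lemma mul_pow_eq (h : IsTwistedPair u a b) (p : ℕ) : b * a ^ p = a ^ p * (star u ^ p * b) := by
  have hcomm := h.symm.commute_right
  have hsemi : SemiconjBy b a (star u * a) := h.symm.mul_eq
  rw [(hsemi.pow_right p).eq, hcomm.mul_pow, (hcomm.pow_pow p p).eq, mul_assoc]

end Monoid

variable {𝕜 H : Type*} [RCLike 𝕜] [NormedAddCommGroup H] [InnerProductSpace 𝕜 H]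
  [CompleteSpace H] {u a b : H →L[𝕜] H}

lemma map_mem_level (h : IsTwistedPair u a b) (p : ℕ) : ∀ x ∈ level a p, b x ∈ level a p := by
  rintro _ ⟨w, hw, rfl⟩
  refine ⟨(star u ^ p * b) w, ?_, (DFunLike.congr_fun (h.mul_pow_eq p) w).symm⟩
  have hmul : star a * (star u ^ p * b) = star u ^ p * (star u * b) * star a := by
    rw [← mul_assoc, ← (h.commute_left.star_star.pow_left p).eq, mul_assoc, h.star_mul_eq,
      ← mul_assoc (star u ^ p)]
  calc a.adjoint ((star u ^ p * b) w) = (star u ^ p * (star u * b)) (a.adjoint w) :=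
        DFunLike.congr_fun hmul w
    _ = 0 := by rw [show a.adjoint w = 0 from hw, map_zero]

lemma reduces_level (h : IsTwistedPair u a b) (ha : IsWoldRegular a) (p : ℕ) :
    Reduces b (level a p) :=
  ⟨ha.isClosed_level p, h.map_mem_level p, h.star_right.map_mem_level p⟩

end IsTwistedPair

namespace IsDoublyTwisted

variable {n : ℕ} {H : Type*} [NormedAddCommGroup H] [InnerProductSpace ℂ H] [CompleteSpace H]
  {U : Fin n → Fin n → (H →L[ℂ] H)} {T : Fin n → (H →L[ℂ] H)}

lemma isTwistedPair (hT : IsDoublyTwisted U T) {i j : Fin n} (hij : i < j) :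
    IsTwistedPair (U i j) (T i) (T j) where
  mem_unitary := hT.unitary i j hij
  commute_left := (hT.mul_unitary i j i hij).symm
  commute_right := (hT.mul_unitary i j j hij).symm
  mul_eq := hT.mul_mul i j hij
  star_mul_eq := hT.adjoint_mul i j hij

theorem isWoldFamily (hT : IsDoublyTwisted U T) : IsWoldFamily T where
  isWoldRegular i := (hT.nearIsometry i).isWoldRegular
  reduces_level i j hij p := by
    have hi := (hT.nearIsometry i).isWoldRegular
    rcases hij.lt_or_gt with h | h
    exacts [(hT.isTwistedPair h).reduces_level hi p, (hT.isTwistedPair h).symm.reduces_level hi p]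

end IsDoublyTwisted

end Twisted

section Polar

variable {𝕜 E F : Type*} [RCLike 𝕜] [NormedAddCommGroup E] [InnerProductSpace 𝕜 E]
  [NormedAddCommGroup F] [InnerProductSpace 𝕜 F]

lemma norm_eq_of_inner_apply_apply_eq [CompleteSpace E] {S : E →L[𝕜] F} {P : E →L[𝕜] E}
    (hP : IsSelfAdjoint P) (h : ∀ x y, ⟪P (P x), y⟫_𝕜 = ⟪S x, S y⟫_𝕜) (x : E) : ‖P x‖ = ‖S x‖ := by
  have hinner : ⟪P x, P x⟫_𝕜 = ⟪S x, S x⟫_𝕜 := by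
    rw [← h, ← adjoint_inner_left, hP.adjoint_eq]
  rw [@norm_eq_sqrt_re_inner 𝕜, hinner, ← @norm_eq_sqrt_re_inner 𝕜]

lemma bijective_of_isSelfAdjoint_of_antilipschitzWith [CompleteSpace E] {P : E →L[𝕜] E}
    (hP : IsSelfAdjoint P) {c : NNReal} (hc : AntilipschitzWith c P) : Function.Bijective P := by
  refine ⟨hc.injective, LinearMap.range_eq_top.mp ?_⟩
  have hclosed : IsClosed (P.range : Set E) := hc.isClosed_range P.uniformContinuous
  rw [← hclosed.submodule_topologicalClosure_eq, topologicalClosure_eq_top_iff,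
    P.orthogonal_range, hP.adjoint_eq]
  exact LinearMap.ker_eq_bot.mpr hc.injective

lemma exists_linearIsometryEquiv_apply_eq {𝕜 E F : Type*} [NontriviallyNormedField 𝕜]
    [NormedAddCommGroup E] [NormedSpace 𝕜 E] [NormedAddCommGroup F] [NormedSpace 𝕜 F]
    {S : E →L[𝕜] F} {P : E →L[𝕜] E} (hP : Function.Bijective P)
    (hnorm : ∀ x, ‖P x‖ = ‖S x‖) {R : Submodule 𝕜 F} (hR : S.range = R) :
    ∃ Λ : E ≃ₗᵢ[𝕜] R, ∀ x, (Λ (P x) : F) = S x := by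
  let Q : E ≃ₗ[𝕜] E := .ofBijective P.toLinearMap hP
  have hQ : ∀ x, Q.symm (P x) = x := Q.symm_apply_apply
  subst hR
  let Λ : E →ₗᵢ[𝕜] S.range :=
    { toLinearMap := S.toLinearMap.rangeRestrict ∘ₗ Q.symm.toLinearMap
      norm_map' := hP.surjective.forall.mpr fun x => by
        change ‖S (Q.symm (P x))‖ = ‖P x‖
        rw [hQ, hnorm] }
  have hΛ : ∀ x, (Λ (P x) : F) = S x := fun x => congrArg S (hQ x)
  refine ⟨.ofSurjective Λ ?_, hΛ⟩
  rintro ⟨_, x, rfl⟩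
  exact ⟨P x, Subtype.ext (hΛ x)⟩

theorem exists_isPolarUnitary_of_antilipschitzWith {E F : Type*} [NormedAddCommGroup E]
    [InnerProductSpace ℂ E] [CompleteSpace E] [NormedAddCommGroup F] [InnerProductSpace ℂ F]
    [CompleteSpace F] {S : E →L[ℂ] F} {c : NNReal} (hS : AntilipschitzWith c S) {R : Submodule ℂ F}
    (hR : S.range = R) : ∃ Λ : E ≃ₗᵢ[ℂ] R, IsPolarUnitary S Λ := by
  have hG : 0 ≤ S.adjoint ∘L S := (nonneg_iff_isPositive _).mpr (isPositive_adjoint_comp_self S)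
  set P : E →L[ℂ] E := CFC.sqrt (S.adjoint ∘L S)
  have hP : P.IsPositive := (nonneg_iff_isPositive _).mp (CFC.sqrt_nonneg _)
  have hPP : P * P = S.adjoint ∘L S := CFC.sqrt_mul_sqrt_self _ hG
  have hinner : ∀ x y, ⟪P (P x), y⟫_ℂ = ⟪S x, S y⟫_ℂ := fun x y => by
    rw [← adjoint_inner_left]
    exact congrArg (⟪·, y⟫_ℂ) (DFunLike.congr_fun hPP x)
  have hnorm := norm_eq_of_inner_apply_apply_eq hP.isSelfAdjoint hinner
  have hbij : Function.Bijective P :=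
    bijective_of_isSelfAdjoint_of_antilipschitzWith hP.isSelfAdjoint <|
      P.antilipschitz_of_bound fun x => (hnorm x).symm ▸ S.bound_of_antilipschitz hS x
  obtain ⟨Λ, hΛ⟩ := exists_linearIsometryEquiv_apply_eq hbij hnorm hR
  exact ⟨Λ, P, hP, hinner, hΛ⟩

end Polar

section HilbertSum

lemma exists_lp_equiv_of_pairwise_isOrtho {𝕜 H ι : Type*} [RCLike 𝕜] [NormedAddCommGroup H]
    [InnerProductSpace 𝕜 H] [CompleteSpace H] {G : ι → Type*} [∀ i, NormedAddCommGroup (G i)]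
    [∀ i, InnerProductSpace 𝕜 (G i)] [∀ i, CompleteSpace (G i)] [DecidableEq ι]
    {B : ι → Submodule 𝕜 H} (hB : Pairwise fun i j => B i ⟂ B j) (Λ : ∀ i, G i ≃ₗᵢ[𝕜] B i) :
    ∃ Φ : lp G 2 ≃ₗᵢ[𝕜] (⨆ i, B i).topologicalClosure,
      ∀ i η, (Φ (lp.single 2 i η) : H) = Λ i η := by
  let Ψ : ∀ i, G i →ₗᵢ[𝕜] H := fun i => (B i).subtypeₗᵢ.comp (Λ i).toLinearIsometry
  have hΨ : OrthogonalFamily 𝕜 G Ψ := fun i j hij x y =>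
    isOrtho_iff_inner_eq.mp (hB hij) _ (Λ i x).2 _ (Λ j y).2
  have hrange : ∀ i, LinearMap.range (Ψ i).toLinearMap = B i := fun i =>
    ((Λ i).toLinearEquiv.range_comp (B i).subtype).trans (B i).range_subtype
  have hclosure : hΨ.linearIsometry.toLinearMap.range = (⨆ i, B i).topologicalClosure := by
    rw [hΨ.range_linearIsometry]
    simp_rw [hrange]
  exact ⟨hΨ.linearIsometry.equivRange.trans (.ofEq _ _ hclosure),
    fun i η => hΨ.linearIsometry_apply_single η⟩

end HilbertSum

section HardyModel

lemma summable_prod_pow {m : ℕ} {r : Fin m → ℝ} (h0 : ∀ i, 0 ≤ r i) (h1 : ∀ i, r i < 1) :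
    Summable fun k : Fin m → ℕ => ∏ i, r i ^ k i := by
  induction m with
  | zero => exact (hasSum_unique _).summable
  | succ m ih =>
    rw [← (Fin.consEquiv fun _ : Fin (m + 1) => ℕ).summable_iff]
    have hmul := (summable_geometric_of_lt_one (h0 0) (h1 0)).mul_of_nonneg
      (ih (fun i => h0 i.succ) fun i => h1 i.succ) (fun p => pow_nonneg (h0 0) p)
      fun k => Finset.prod_nonneg fun i _ => pow_nonneg (h0 i.succ) (k i)
    exact hmul.congr fun p => by simp [Fin.prod_univ_succ, Fin.consEquiv]

variable {m : ℕ} {E : Type*} [NormedAddCommGroup E] [InnerProductSpace ℂ E]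

lemma summable_norm_mpow_sq {z : Fin m → ℂ} (hz : z ∈ polydisc m) :
    Summable fun k => ‖mpow z k‖ ^ 2 := by
  refine (summable_prod_pow (r := fun i => ‖z i‖ ^ 2) (fun i => by positivity) fun i =>
    pow_lt_one₀ (norm_nonneg _) (hz i) two_ne_zero).congr fun k => ?_
  rw [mpow, norm_prod, ← Finset.prod_pow]
  exact Finset.prod_congr rfl fun i _ => by rw [norm_pow, pow_right_comm]

lemma exists_isCoeff [CompleteSpace E] (a : CoeffSpace m E) :
    ∃ f : polydisc m → E, IsCoeff a f := by
  refine ⟨fun z => ∑' k, mpow z.1 k • a k, fun z => Summable.hasSum ?_⟩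
  have ha : Summable fun k => ‖a k‖ ^ 2 := by
    simpa using (lp.memℓp a).summable (by norm_num)
  refine .of_norm_bounded ((summable_norm_mpow_sq z.2).add ha) fun k => ?_
  rw [norm_smul]
  nlinarith [two_mul_le_add_sq ‖mpow z.1 k‖ ‖a k‖, sq_nonneg ‖mpow z.1 k‖, sq_nonneg ‖a k‖]

namespace HardySpace

lemma coeff_monomial (k : Fin m → ℕ) (η : E) : coeff (monomial k η) = lp.single 2 k η :=
  (isCoeff_coeff _).unique (isCoeff_single k η)

variable (m E) in
/-- The isometry between the Hardy space and `ℓ²(ℕ^m, E)` given by the power series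
coefficients. -/
def coeffEquiv [CompleteSpace E] : HardySpace m E ≃ₗᵢ[ℂ] CoeffSpace m E :=
  .ofSurjective ⟨coeff, fun _ => rfl⟩ fun a => by
    obtain ⟨f, hf⟩ := exists_isCoeff a
    exact ⟨⟨f, a, hf⟩, (isCoeff_coeff _).unique hf⟩

lemma exists_equiv_of_pairwise_isOrtho {H : Type*} [NormedAddCommGroup H]
    [InnerProductSpace ℂ H] [CompleteSpace H] [CompleteSpace E] {B : (Fin m → ℕ) → Submodule ℂ H}
    (hB : Pairwise fun k l => B k ⟂ B l) (Λ : ∀ k, E ≃ₗᵢ[ℂ] B k) :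
    ∃ V : ↥(⨆ k, B k).topologicalClosure ≃ₗᵢ[ℂ] HardySpace m E,
      ∀ k η, (V.symm (monomial k η) : H) = Λ k η := by
  obtain ⟨Φ, hΦ⟩ := exists_lp_equiv_of_pairwise_isOrtho hB Λ
  refine ⟨Φ.symm.trans (coeffEquiv m E).symm, fun k η => ?_⟩
  rw [← hΦ, ← coeff_monomial]
  rfl

end HardySpace

end HardyModel

section Model

variable {n : ℕ} {H : Type*} [NormedAddCommGroup H] [InnerProductSpace ℂ H] [CompleteSpace H]
  {T : Fin n → (H →L[ℂ] H)} {A : Finset (Fin n)}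

lemma IsWoldFamily.exists_isPolarUnitary (hT : IsWoldFamily T) (A : Finset (Fin n))
    (k : Fin A.card → ℕ) : ∃ Λ : wandering T A ≃ₗᵢ[ℂ] block T A k,
      IsPolarUnitary ((opPow T A k).domRestrict (wandering T A)) Λ := by
  have : CompleteSpace (wandering T A) := (hT.isClosed_wandering A).completeSpace_coe
  obtain ⟨c, hc⟩ := exists_antilipschitzWith_powProd
    (fun r => (hT.comp_orderEmbOfFin A).isWoldRegular r |>.antilipschitz) k
  exact exists_isPolarUnitary_of_antilipschitzWith (hc.domRestrict _)
    (LinearMap.range_domRestrict _ _)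

section Weight

variable (Λ : ∀ k, wandering T A ≃ₗᵢ[ℂ] block T A k) (S : H →L[ℂ] H) (k l : Fin A.card → ℕ)
  (h : Set.MapsTo S (block T A k) (block T A l))

lemma coe_apply_weight (η : wandering T A) : (Λ l (weight Λ S k l h η) : H) = S (Λ k η) :=
  congrArg Subtype.val ((Λ l).apply_symm_apply ⟨S (Λ k η), h (Λ k η).2⟩)

lemma norm_weight_le : ‖weight Λ S k l h‖ ≤ ‖S‖ := by
  refine opNorm_le_bound _ (norm_nonneg _) fun η => ?_
  rw [← (Λ l).norm_map, ← (Λ k).norm_map η, coe_norm, coe_norm, coe_apply_weight]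
  exact S.le_opNorm _

end Weight

/-- The operator on `F` that corresponds to the restriction of `S` to the invariant subspace `K`
under the unitary `V : K → F`. -/
def transport {F : Type*} [NormedAddCommGroup F] [InnerProductSpace ℂ F] {K : Submodule ℂ H}
    (V : K ≃ₗᵢ[ℂ] F) (S : H →L[ℂ] H) (hS : Set.MapsTo S K K) : F →L[ℂ] F :=
  (V : K →L[ℂ] F) ∘L S.restrict hS ∘L (V.symm : F →L[ℂ] K)

section Transport

open HardySpace

variable {Λ : ∀ k, wandering T A ≃ₗᵢ[ℂ] block T A k}
  {V : woldSummand T A ≃ₗᵢ[ℂ] HardySpace A.card (wandering T A)}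

lemma apply_toSummand (hV : ∀ k η, (V.symm (monomial k η) : H) = Λ k η) (k : Fin A.card → ℕ)
    (η : wandering T A) :
    V (toSummand T A k η) = monomial k ((Λ k).symm (toBlock T A k η)) := by
  rw [← V.eq_symm_apply, ← SetLike.coe_eq_coe, hV, LinearIsometryEquiv.apply_symm_apply]
  rfl

lemma transport_monomial (hV : ∀ k η, (V.symm (monomial k η) : H) = Λ k η) (S : H →L[ℂ] H)
    (hS : Set.MapsTo S (woldSummand T A) (woldSummand T A)) {k l : Fin A.card → ℕ}
    (h : Set.MapsTo S (block T A k) (block T A l)) (η : wandering T A) :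
    transport V S hS (monomial k η) = monomial l (weight Λ S k l h η) := by
  change V (S.restrict hS (V.symm (monomial k η))) = _
  rw [← V.eq_symm_apply, ← SetLike.coe_eq_coe, hV, coe_apply_weight]
  exact congrArg S (hV k η)

end Transport

end Model

end NearIsom

end

open NearIsom in
theorem theorem1_general {n : ℕ} {H : Type*} [NormedAddCommGroup H] [InnerProductSpace ℂ H]
    [CompleteSpace H] (T : Fin n → (H →L[ℂ] H)) (hT : IsWoldFamily T) (A : Finset (Fin n)) :
    IsWoldDecomposition T (woldSummand T) ∧
    ∃ (hinv : ∀ s, Set.MapsTo (T s) (woldSummand T A) (woldSummand T A))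
      (hshift : ∀ k i, Set.MapsTo (T (A.orderEmbOfFin rfl i))
        (block T A k) (block T A (k + Pi.single i 1)))
      (hdiag : ∀ k, ∀ s ∉ A, Set.MapsTo (T s) (block T A k) (block T A k))
      (Λ : ∀ k, wandering T A ≃ₗᵢ[ℂ] block T A k)
      (M : Fin n → (HardySpace A.card (wandering T A) →L[ℂ]
        HardySpace A.card (wandering T A)))
      (V : woldSummand T A ≃ₗᵢ[ℂ]
        HardySpace A.card (wandering T A)),
      (∀ k, IsPolarUnitary
        ((opPow T A k).domRestrict (wandering T A)) (Λ k)) ∧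
      (∀ k η, V (toSummand T A k η) =
        HardySpace.monomial k ((Λ k).symm (toBlock T A k η))) ∧
      (∀ s f, V ((T s).restrict (hinv s) (V.symm f)) = M s f) ∧
      HardySpace.IsMultishift
        (fun k i => weight Λ (T (A.orderEmbOfFin rfl i)) k (k + Pi.single i 1)
          (hshift k i))
        (fun i => M (A.orderEmbOfFin rfl i)) ∧
      ∀ s, ∀ hs : s ∉ A, HardySpace.IsBlockDiagonal
        (fun k => weight Λ (T s) k k (hdiag k s hs)) (M s) := by
  have hinv : ∀ s, Set.MapsTo (T s) (woldSummand T A) (woldSummand T A) :=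
    fun s => (hT.reduces_woldSummand A s).map_mem
  have : CompleteSpace (wandering T A) := (hT.isClosed_wandering A).completeSpace_coe
  choose Λ hΛ using hT.exists_isPolarUnitary A
  obtain ⟨V, hV⟩ : ∃ V : woldSummand T A ≃ₗᵢ[ℂ] HardySpace A.card (wandering T A),
      ∀ k η, (V.symm (HardySpace.monomial k η) : H) = Λ k η :=
    HardySpace.exists_equiv_of_pairwise_isOrtho (fun k l => hT.block_isOrtho A) Λ
  have hbound : ∀ s k l h, ‖weight Λ (T s) k l h‖ ≤ ‖T‖ := fun s k l h =>
    (norm_weight_le Λ (T s) k l h).trans (norm_le_pi_norm T s)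
  exact ⟨hT.isWoldDecomposition, hinv, hT.mapsTo_block_succ A,
    fun k s hs => hT.mapsTo_block A k hs, Λ, fun s => transport V (T s) (hinv s), V, hΛ,
    apply_toSummand hV, fun s f => rfl,
    ⟨⟨‖T‖, fun k i => hbound _ _ _ _⟩, fun i k => transport_monomial hV _ _ _⟩,
    fun s hs => ⟨⟨‖T‖, fun k => hbound _ _ _ _⟩, fun k => transport_monomial hV _ _ _⟩⟩

theorem theorem1 {n : ℕ} {H : Type*} [NormedAddCommGroup H] [InnerProductSpace ℂ H]
    [CompleteSpace H] (U : Fin n → Fin n → (H →L[ℂ] H)) (T : Fin n → (H →L[ℂ] H))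
    (hT : NearIsom.IsDoublyTwisted U T) (A : Finset (Fin n)) (hA : A.Nonempty) :
    NearIsom.IsWoldDecomposition T (NearIsom.woldSummand T) ∧
    ∃ (hinv : ∀ s, Set.MapsTo (T s) (NearIsom.woldSummand T A) (NearIsom.woldSummand T A))
      (hshift : ∀ k i, Set.MapsTo (T (A.orderEmbOfFin rfl i))
        (NearIsom.block T A k) (NearIsom.block T A (k + Pi.single i 1)))
      (hdiag : ∀ k, ∀ s ∉ A, Set.MapsTo (T s) (NearIsom.block T A k) (NearIsom.block T A k))
      (Λ : ∀ k, NearIsom.wandering T A ≃ₗᵢ[ℂ] NearIsom.block T A k)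
      (M : Fin n → (NearIsom.HardySpace A.card (NearIsom.wandering T A) →L[ℂ]
        NearIsom.HardySpace A.card (NearIsom.wandering T A)))
      (V : NearIsom.woldSummand T A ≃ₗᵢ[ℂ]
        NearIsom.HardySpace A.card (NearIsom.wandering T A)),
      (∀ k, NearIsom.IsPolarUnitary
        ((NearIsom.opPow T A k).domRestrict (NearIsom.wandering T A)) (Λ k)) ∧
      (∀ k η, V (NearIsom.toSummand T A k η) =
        NearIsom.HardySpace.monomial k ((Λ k).symm (NearIsom.toBlock T A k η))) ∧
      (∀ s f, V ((T s).restrict (hinv s) (V.symm f)) = M s f) ∧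
      NearIsom.HardySpace.IsMultishift
        (fun k i => NearIsom.weight Λ (T (A.orderEmbOfFin rfl i)) k (k + Pi.single i 1)
          (hshift k i))
        (fun i => M (A.orderEmbOfFin rfl i)) ∧
      ∀ s, ∀ hs : s ∉ A, NearIsom.HardySpace.IsBlockDiagonal
        (fun k => NearIsom.weight Λ (T s) k k (hdiag k s hs)) (M s) :=
  theorem1_general T hT.isWoldFamily A
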